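/- Let $n\ge 0$ and let $\mathcal F=\mathrm{GL}(n,\mathbb C)/B$ be the variety of complete flags $0=V_0\subset V_1\subset\dots\subset V_n=\mathbb C^n$, $\dim V_k=k$, where $B$ is the group of invertible upper triangular matrices, and let $F_0$ be the standard flag, $V_k=\langle\varepsilon_1,\dots,\varepsilon_k\rangle$. For $w\in S_n$ let $wF_0$ be the flag with $V_k=\langle\varepsilon_{w(1)},\dots,\varepsilon_{w(k)}\rangle$, and let the Schubert variety $\mathcal X_w$ be the closure in $\mathcal F$ of the orbit $B\cdot wF_0$. Near $F_0$ use the coordinates $x=(x_{ij})_{1\le j<i\le n}$, where $x$ corresponds to the flag whose space $V_k$ is spanned by the first $k$ columns of the lower unitriangular matrix with entries $x_{ij}$ below the diagonal; $F_0$ has coordinates $0$, and the $x_{ij}$ are also used as coordinates on the tangent space $T_{F_0}\mathcal F$. Let $X_w\subset\mathbb C^{n(n-1)/2}$ be $\mathcal X_w$ in these coordinates. The tangent cone $\mathcal T_w\subset T_{F_0}\mathcal F$ of $\mathcal X_w$ at $F_0$ is the set of limits of $c_m d_m$ with $c_m\in\mathbb C$, $d_m\in X_w$, $d_m\to 0$;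 its ideal $I(\mathcal T_w)\subset\mathbb C[x_{ij}]$ is the ideal generated by the lowest degree homogeneous parts of all polynomials that vanish on $X_w$. An element $w\in S_n$ is called a Coxeter element if it is a product, in some order, of the elementary transpositions $s_1,\dots,s_{n-1}$, $s_i=(i\;\,i+1)$, each used exactly once (for $n\le 1$ the identity). Then all Schubert varieties $\mathcal X_w$ with $w$ a Coxeter element of $S_n$ have the same tangent cone at $F_0$: if $w,w'\in S_n$ are Coxeter elements, then $\mathcal T_w=\mathcal T_{w'}$ and $I(\mathcal T_w)=I(\mathcal T_{w'})$. Explicitly, for every Coxeter element $w\in S_n$, the cone $\mathcal T_w$ is the linear subspace $$\{x : x_{ij}=0\ \text{ for all } i,j \text{ with } i-j>1\},$$ and $I(\mathcal T_w)$ is generated by the coordinates $x_{ij}$ with $i-j>1$. -/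

import Mathlib

noncomputable section

namespace FlagVariety

open scoped MatrixGroups

/-- A complete flag `0 = V_0 ⊂ V_1 ⊂ ⋯ ⊂ V_n = ℂⁿ` with `dim V_k = k`. -/
@[ext]
structure CompleteFlag (n : ℕ) where
  space : Fin (n + 1) → Submodule ℂ (Fin n → ℂ)
  mono : Monotone space
  finrank_eq : ∀ k, Module.finrank ℂ (space k) = k

/-- The flag of an ordered basis `v` of `ℂⁿ`: the space `V_k` is spanned by the first `k` vectors
(indices start at `0`, so these are the `v j` with `j < k`). -/
def flagOfBasis {n : ℕ} (v : Fin n → Fin n → ℂ) (hv : LinearIndependent ℂ v) :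
    CompleteFlag n where
  space k := Submodule.span ℂ (v '' {j : Fin n | (j : ℕ) < (k : ℕ)})
  mono k l hkl := Submodule.span_mono
    (Set.image_mono fun _ hj => lt_of_lt_of_le hj (Fin.le_def.1 hkl))
  finrank_eq k := by
    classical
    have h1 : v '' {j : Fin n | (j : ℕ) < (k : ℕ)} =
        Set.range (v ∘ (Subtype.val : {j : Fin n // (j : ℕ) < (k : ℕ)} → Fin n)) := by
      ext x; simp
    rw [h1, finrank_span_eq_card (hv.comp _ Subtype.val_injective), Fintype.card_subtype]
    exact Fin.card_filter_val_lt.trans (min_eq_right (Nat.lt_succ_iff.1 k.2))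

theorem linearIndependent_single_perm {n : ℕ} (w : Equiv.Perm (Fin n)) :
    LinearIndependent ℂ (fun j => Pi.single (w j) 1 : Fin n → Fin n → ℂ) := by
  have h := (Pi.basisFun ℂ (Fin n)).linearIndependent.comp w w.injective
  convert h using 1
  funext j
  simp

/-- The image `w F₀` of the standard flag under the permutation of coordinates
`ε_j ↦ ε_{w(j)}`: its `k`-th space is spanned by `ε_{w(1)}, …, ε_{w(k)}`. -/
def permFlag {n : ℕ} (w : Equiv.Perm (Fin n)) : CompleteFlag n :=
  flagOfBasis (fun j => Pi.single (w j) 1) (linearIndependent_single_perm w)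

/-- The standard flag `F₀`, with `V_k = ⟨ε_1, …, ε_k⟩`. -/
def stdFlag (n : ℕ) : CompleteFlag n := permFlag 1

theorem mulVecLin_injective {n : ℕ} (g : GL (Fin n) ℂ) :
    Function.Injective (Matrix.mulVecLin (g : Matrix (Fin n) (Fin n) ℂ)) :=
  Matrix.mulVec_injective_of_isUnit g.isUnit

/-- `GL(n, ℂ)` acts on flags by `(V_k) ↦ (g V_k)`. -/
instance (n : ℕ) : MulAction (GL (Fin n) ℂ) (CompleteFlag n) where
  smul g F :=
    { space := fun k =>
        (F.space k).map (Matrix.mulVecLin (g : Matrix (Fin n) (Fin n) ℂ))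
      mono := fun _ _ hkl => Submodule.map_mono (F.mono hkl)
      finrank_eq := fun k =>
        (LinearEquiv.finrank_eq ((F.space k).equivMapOfInjective _
          (mulVecLin_injective g))).symm.trans (F.finrank_eq k) }
  one_smul F := by
    ext1; funext k
    change (F.space k).map (Matrix.mulVecLin ((1 : GL (Fin n) ℂ) : Matrix (Fin n) (Fin n) ℂ)) = _
    simp
  mul_smul g h F := by
    ext1; funext k
    change (F.space k).map (Matrix.mulVecLin ((g * h : GL (Fin n) ℂ) : Matrix (Fin n) (Fin n) ℂ)) =
      ((F.space k).map (Matrix.mulVecLin (h : Matrix (Fin n) (Fin n) ℂ))).map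
        (Matrix.mulVecLin (g : Matrix (Fin n) (Fin n) ℂ))
    rw [Units.val_mul, Matrix.mulVecLin_mul, Submodule.map_comp]

/-- The flag variety carries the quotient topology of `GL(n, ℂ) / B`, i.e. the finest topology for
which the orbit map `g ↦ g F₀` is continuous. (Closures of Schubert cells are the same for this
topology and for the Zariski topology.) -/
instance (n : ℕ) : TopologicalSpace (CompleteFlag n) :=
  TopologicalSpace.coinduced (fun g : GL (Fin n) ℂ => g • stdFlag n) inferInstance

/-- The Borel subgroup `B` of invertible upper triangular matrices. -/
def borel (n : ℕ) : Subgroup (GL (Fin n) ℂ) where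
  carrier := {b | ∀ i j : Fin n, j < i → (b : Matrix (Fin n) (Fin n) ℂ) i j = 0}
  one_mem' i j hij := by simp [hij.ne']
  mul_mem' {a b} ha hb i j hij := by
    have h : Matrix.BlockTriangular ((a : Matrix (Fin n) (Fin n) ℂ) *
        (b : Matrix (Fin n) (Fin n) ℂ)) id :=
      Matrix.BlockTriangular.mul (fun i j h => ha i j h) (fun i j h => hb i j h)
    exact h hij
  inv_mem' {a} ha i j hij := by
    have := a.invertible
    have h := Matrix.blockTriangular_inv_of_blockTriangular
      (M := (a : Matrix (Fin n) (Fin n) ℂ)) (b := id) (fun i j h => ha i j h)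
    rw [Matrix.coe_units_inv]
    exact h hij

/-- The Schubert cell `C_w`: the `B`-orbit of `w F₀`. -/
def schubertCell {n : ℕ} (w : Equiv.Perm (Fin n)) : Set (CompleteFlag n) :=
  MulAction.orbit (borel n) (permFlag w)

/-- The Schubert variety `X_w`: the closure of the Schubert cell in the flag variety. -/
def schubertVariety {n : ℕ} (w : Equiv.Perm (Fin n)) : Set (CompleteFlag n) :=
  closure (schubertCell w)

/-- Index set of the coordinates `x_{ij}`, `i > j`. -/
abbrev LowerIndex (n : ℕ) : Type := {p : Fin n × Fin n // p.2 < p.1}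

/-- The lower unitriangular matrix with entries `x_{ij}` below the diagonal. -/
def unitriangular {n : ℕ} (x : LowerIndex n → ℂ) : Matrix (Fin n) (Fin n) ℂ :=
  fun i j => if h : j < i then x ⟨(i, j), h⟩ else if i = j then 1 else 0

theorem linearIndependent_unitriangular_col {n : ℕ} (x : LowerIndex n → ℂ) :
    LinearIndependent ℂ (unitriangular x).col := by
  rw [Matrix.linearIndependent_cols_iff_isUnit, Matrix.isUnit_iff_isUnit_det,
    Matrix.det_of_isLowerTriangular]
  · simp [unitriangular]
  · intro i j (hij : i < j)
    simp [unitriangular, hij.not_gt, hij.ne]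

/-- The local coordinate system of the flag variety around `F₀` (which has coordinates `0`):
`x` is sent to the flag whose `k`-th space is spanned by the first `k` columns of
`unitriangular x`. The same `x_{ij}` are the coordinates of the tangent space at `F₀`. -/
def chart {n : ℕ} (x : LowerIndex n → ℂ) : CompleteFlag n :=
  flagOfBasis (unitriangular x).col (linearIndependent_unitriangular_col x)

/-- The Schubert variety in the local coordinates. -/
def localSchubert {n : ℕ} (w : Equiv.Perm (Fin n)) : Set (LowerIndex n → ℂ) :=
  {x | chart x ∈ schubertVariety w}

/-- The tangent cone `T_w` as a set of tangent vectors at `F₀`: limits of rescaled secant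
vectors `c • d`, where `d → 0` runs through points of `X_w` in the chart around `F₀`. -/
def tangentCone {n : ℕ} (w : Equiv.Perm (Fin n)) : Set (LowerIndex n → ℂ) :=
  tangentConeAt ℂ (localSchubert w) 0

/-- The ideal generated by the initial forms (lowest degree homogeneous parts) of the elements
of an ideal of polynomials. -/
def initialIdeal {σ : Type*} (I : Ideal (MvPolynomial σ ℂ)) : Ideal (MvPolynomial σ ℂ) :=
  Ideal.span {q | ∃ p ∈ I, ∃ d : ℕ,
    (∀ e < d, MvPolynomial.homogeneousComponent e p = 0) ∧
      q = MvPolynomial.homogeneousComponent d p}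

/-- The ideal of the tangent cone `T_w`: it is generated by the lowest degree homogeneous parts
of the polynomials in the `x_{ij}` that vanish on `X_w`. -/
def tangentConeIdeal {n : ℕ} (w : Equiv.Perm (Fin n)) : Ideal (MvPolynomial (LowerIndex n) ℂ) :=
  initialIdeal (MvPolynomial.vanishingIdeal ℂ (localSchubert w))

/-- The elementary transposition `s_i` exchanging `i` and `i + 1` (counted from `0`). -/
def elemTransposition {n : ℕ} (i : Fin (n - 1)) : Equiv.Perm (Fin n) :=
  Equiv.swap ⟨i, by omega⟩ ⟨i + 1, by omega⟩

/-- `w` is a Coxeter element of `S_n`: a product of all elementary transpositions, in some order,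
in which each of them enters exactly once. -/
def IsCoxeterElement {n : ℕ} (w : Equiv.Perm (Fin n)) : Prop :=
  ∃ l : List (Fin (n - 1)), l.Nodup ∧ (∀ i, i ∈ l) ∧ w = (l.map elemTransposition).prod

end FlagVariety

end

/-! ### Incidence with the standard flag, and Schubert cells as double cosets -/

noncomputable section

namespace FlagVariety

open Matrix Filter Topology

variable {n : ℕ}

/-! The linear subspace is bounded from both sides: equations of the Schubert variety show that the
cone is no larger, explicit curves show that it is no smaller.

Equations. For each `j` with `j + 2 < n`, either `w` or `w⁻¹` sends the first `j + 1` indices into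
the first `j + 2`, according to the order of `s_j` and `s_{j+1}` in the word
(`IsCoxeterElement.apply_lt_or_inv_apply_lt`). This yields a closed incidence relation between the
flag and the standard flag. In coordinates it reads `x_{ij} = 0` or `x_{ij} = x_{j+1,j} x_{i,j+1}`
for every `i > j + 1` (`IsCoxeterElement.exists_equation`). Either way `x_{ij}` is the linear part
of an equation.

Curves. The product of the matrices `1 + ε c_i E_{i+1,i}`, in the order of the word, lies in `BwB`
when all `ε c_i` are nonzero (`exists_prod_lowerRoot_eq`), by a rank-one Bruhat decomposition at
each factor. It is `1 + ε R` with `R` tending to `∑ c_i E_{i+1,i}`, so every vector of the subspace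
is a limit of secants (`IsCoxeterElement.exists_curve`). Along such curves lowest forms must vanish
too, which settles the ideal. -/

theorem smul_space (g : GL (Fin n) ℂ) (F : CompleteFlag n) (k : Fin (n + 1)) :
    (g • F).space k = (F.space k).map (mulVecLin (g : Matrix (Fin n) (Fin n) ℂ)) := rfl

theorem stdFlag_space (k : Fin (n + 1)) :
    (stdFlag n).space k = Submodule.span ℂ
      ((fun j : Fin n => (Pi.single j 1 : Fin n → ℂ)) '' {j : Fin n | (j : ℕ) < (k : ℕ)}) := rfl

theorem mem_stdFlag_space {k : Fin (n + 1)} {v : Fin n → ℂ} :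
    v ∈ (stdFlag n).space k ↔ ∀ i : Fin n, (k : ℕ) ≤ i → v i = 0 := by
  rw [stdFlag_space]
  constructor
  · intro hv i hi
    induction hv using Submodule.span_induction with
    | mem x hx =>
      obtain ⟨j, hj, rfl⟩ := hx
      have : i ≠ j := by rintro rfl; exact absurd hj (by simpa using hi)
      simp [this]
    | zero => rfl
    | add x y _ _ hx hy => simp [hx, hy]
    | smul a x _ hx => simp [hx]
  · intro h
    rw [pi_eq_sum_univ' v]
    refine Submodule.sum_mem _ fun i _ => ?_
    by_cases hi : (k : ℕ) ≤ i
    · simp [h i hi]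
    · refine Submodule.smul_mem _ _ (Submodule.subset_span ⟨i, not_le.1 hi, ?_⟩)
      ext j; simp [Pi.single_apply, eq_comm]

theorem smul_stdFlag_eq_flagOfBasis (g : GL (Fin n) ℂ) {M : Matrix (Fin n) (Fin n) ℂ}
    (hgM : (g : Matrix (Fin n) (Fin n) ℂ) = M) (hM : LinearIndependent ℂ M.col) :
    g • stdFlag n = flagOfBasis M.col hM := by
  subst hgM
  ext1; funext k
  rw [smul_space, stdFlag_space, Submodule.map_span, Set.image_image]
  simp [flagOfBasis]

theorem smul_stdFlag_space_le_iff (g : GL (Fin n) ℂ) (k l : Fin (n + 1)) :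
    (g • stdFlag n).space k ≤ (stdFlag n).space l ↔
      ∀ i j : Fin n, (j : ℕ) < k → (l : ℕ) ≤ i → g i j = 0 := by
  rw [smul_space, stdFlag_space k, Submodule.map_span, Set.image_image, Submodule.span_le]
  simp only [Set.subset_def, Set.forall_mem_image, SetLike.mem_coe, mem_stdFlag_space]
  simp only [mulVecLin_apply, mulVec_single_one, col_apply, Set.mem_ofPred_eq]
  exact ⟨fun h i j hj hi => h hj i hi, fun h j hj i hi => h i j hj hi⟩

theorem stdFlag_space_le_smul_iff (g : GL (Fin n) ℂ) (k l : Fin (n + 1)) :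
    (stdFlag n).space k ≤ (g • stdFlag n).space l ↔
      ∀ i j : Fin n, (j : ℕ) < k → (l : ℕ) ≤ i → (g⁻¹ : GL (Fin n) ℂ) i j = 0 := by
  rw [← smul_stdFlag_space_le_iff, smul_space, smul_space]
  constructor
  · intro h
    refine (Submodule.map_mono h).trans ?_
    rw [← Submodule.map_comp, ← mulVecLin_mul, ← Units.val_mul]
    simp
  · intro h
    refine le_trans ?_ (Submodule.map_mono h)
    rw [← Submodule.map_comp, ← mulVecLin_mul, ← Units.val_mul]
    simp

theorem smul_stdFlag_of_mem_borel {b : GL (Fin n) ℂ} (hb : b ∈ borel n) :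
    b • stdFlag n = stdFlag n := by
  have key : ∀ c ∈ borel n, ∀ k, (c • stdFlag n).space k ≤ (stdFlag n).space k := fun c hc k =>
    (smul_stdFlag_space_le_iff c k k).2 fun i j hj hi => hc i j (Fin.lt_def.2 (hj.trans_le hi))
  ext1; funext k
  refine le_antisymm (key b hb k) ?_
  -- The reverse inclusion for `b` is the inclusion already known for `b⁻¹`.
  rw [stdFlag_space_le_smul_iff, ← smul_stdFlag_space_le_iff]
  exact key _ (inv_mem hb) k

/-- The permutation matrix of `w`, sending `ε_j` to `ε_{w(j)}`. -/
def permGL : Equiv.Perm (Fin n) →* GL (Fin n) ℂ :=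
  MonoidHom.toHomUnits
    { toFun := fun w => (1 : Matrix (Fin n) (Fin n) ℂ).submatrix id w
      map_one' := by simp
      map_mul' := fun v w => by
        ext i j
        simp [mul_apply, one_apply] }

theorem coe_permGL (w : Equiv.Perm (Fin n)) :
    (permGL w : Matrix (Fin n) (Fin n) ℂ) = (1 : Matrix (Fin n) (Fin n) ℂ).submatrix id w := rfl

theorem permGL_apply (w : Equiv.Perm (Fin n)) (i j : Fin n) :
    permGL w i j = if i = w j then 1 else 0 := by
  rw [coe_permGL]; simp [one_apply]

theorem permGL_mul_apply (w : Equiv.Perm (Fin n)) (g : GL (Fin n) ℂ) (i j : Fin n) :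
    (permGL w * g : GL (Fin n) ℂ) i j = g (w⁻¹ i) j := by
  rw [Units.val_mul, mul_apply, Finset.sum_eq_single (w⁻¹ i)]
  · simp [permGL_apply]
  · intro k _ hk
    rw [permGL_apply, if_neg, zero_mul]
    rintro rfl; simp at hk
  · simp

theorem mul_permGL_apply (w : Equiv.Perm (Fin n)) (g : GL (Fin n) ℂ) (i j : Fin n) :
    (g * permGL w : GL (Fin n) ℂ) i j = g i (w j) := by
  rw [Units.val_mul, mul_apply, Finset.sum_eq_single (w j)]
  · simp [permGL_apply]
  · intro k _ hk
    rw [permGL_apply, if_neg hk, mul_zero]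
  · simp

theorem permGL_smul_stdFlag (w : Equiv.Perm (Fin n)) : permGL w • stdFlag n = permFlag w := by
  ext1; funext k
  rw [smul_space, stdFlag_space, Submodule.map_span, Set.image_image]
  simp only [permFlag, flagOfBasis, mulVecLin_apply, mulVec_single_one]
  congr 2
  ext j i
  simp [permGL_apply, Pi.single_apply]

theorem mem_schubertCell_iff {w : Equiv.Perm (Fin n)} {F : CompleteFlag n} :
    F ∈ schubertCell w ↔ ∃ b ∈ borel n, F = (b * permGL w) • stdFlag n := by
  rw [schubertCell, MulAction.mem_orbit_iff]
  simp only [mul_smul, permGL_smul_stdFlag]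
  exact ⟨fun ⟨b, hb⟩ => ⟨b, b.2, hb.symm⟩, fun ⟨b, hb, h⟩ => ⟨⟨b, hb⟩, h.symm⟩⟩

/-! ### Closed incidence conditions on Schubert varieties -/

theorem continuous_coe_apply (i j : Fin n) : Continuous fun g : GL (Fin n) ℂ => g i j :=
  (continuous_id.matrix_elem i j).comp Units.continuous_val

theorem continuous_coe_inv_apply (i j : Fin n) :
    Continuous fun g : GL (Fin n) ℂ => (g⁻¹ : GL (Fin n) ℂ) i j :=
  (continuous_coe_apply i j).comp continuous_inv

/-- The topology is coinduced from `GL`, so closedness is tested on matrices, where the condition is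
the vanishing of some entries. -/
theorem isClosed_space_le (k l : Fin (n + 1)) :
    IsClosed {F : CompleteFlag n | F.space k ≤ (stdFlag n).space l} := by
  rw [isClosed_coinduced]
  simp only [Set.preimage_ofPred_eq, smul_stdFlag_space_le_iff, Set.ofPred_forall]
  refine isClosed_iInter fun i => isClosed_iInter fun j => isClosed_iInter fun _ =>
    isClosed_iInter fun _ => isClosed_eq (continuous_coe_apply i j) continuous_const

theorem isClosed_le_space (k l : Fin (n + 1)) :
    IsClosed {F : CompleteFlag n | (stdFlag n).space k ≤ F.space l} := by
  rw [isClosed_coinduced]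
  simp only [Set.preimage_ofPred_eq, stdFlag_space_le_smul_iff, Set.ofPred_forall]
  refine isClosed_iInter fun i => isClosed_iInter fun j => isClosed_iInter fun _ =>
    isClosed_iInter fun _ => isClosed_eq (continuous_coe_inv_apply i j) continuous_const

theorem space_le_of_mem_schubertVariety {w : Equiv.Perm (Fin n)} {k l : Fin (n + 1)}
    (hw : ∀ a : Fin n, (a : ℕ) < k → (w a : ℕ) < l) {F : CompleteFlag n}
    (hF : F ∈ schubertVariety w) : F.space k ≤ (stdFlag n).space l := by
  refine closure_minimal ?_ (isClosed_space_le k l) hF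
  intro F hF
  obtain ⟨b, hb, rfl⟩ := mem_schubertCell_iff.1 hF
  refine (smul_stdFlag_space_le_iff _ k l).2 fun i j hj hi => ?_
  rw [mul_permGL_apply]
  exact hb _ _ (Fin.lt_def.2 ((hw j hj).trans_le hi))

theorem le_space_of_mem_schubertVariety {w : Equiv.Perm (Fin n)} {k l : Fin (n + 1)}
    (hw : ∀ a : Fin n, (a : ℕ) < k → (w⁻¹ a : ℕ) < l) {F : CompleteFlag n}
    (hF : F ∈ schubertVariety w) : (stdFlag n).space k ≤ F.space l := by
  refine closure_minimal ?_ (isClosed_le_space k l) hF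
  intro F hF
  obtain ⟨b, hb, rfl⟩ := mem_schubertCell_iff.1 hF
  refine (stdFlag_space_le_smul_iff _ k l).2 fun i j hj hi => ?_
  rw [_root_.mul_inv_rev, ← map_inv, permGL_mul_apply, inv_inv]
  refine inv_mem hb _ _ (not_le.1 fun h => ?_)
  have := hw (w i) (lt_of_le_of_lt (Fin.le_def.1 h) hj)
  simp at this
  omega

/-! ### Incidence conditions as equations in the chart -/

/-- The invertible matrix `unitriangular x`. -/
def unitriangularGL (x : LowerIndex n → ℂ) : GL (Fin n) ℂ :=
  ((linearIndependent_cols_iff_isUnit.1 (linearIndependent_unitriangular_col x))).unit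

theorem coe_unitriangularGL (x : LowerIndex n → ℂ) :
    (unitriangularGL x : Matrix (Fin n) (Fin n) ℂ) = unitriangular x := rfl

theorem chart_eq_smul {g : GL (Fin n) ℂ} {x : LowerIndex n → ℂ}
    (h : (g : Matrix (Fin n) (Fin n) ℂ) = unitriangular x) : chart x = g • stdFlag n :=
  (smul_stdFlag_eq_flagOfBasis g h (linearIndependent_unitriangular_col x)).symm

theorem unitriangularGL_smul_stdFlag (x : LowerIndex n → ℂ) :
    unitriangularGL x • stdFlag n = chart x :=
  (chart_eq_smul (coe_unitriangularGL x)).symm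

theorem coord_eq_zero_of_chart_space_le {x : LowerIndex n → ℂ} {p : LowerIndex n}
    {k l : Fin (n + 1)} (hk : (p.1.2 : ℕ) < k) (hl : (l : ℕ) ≤ p.1.1)
    (h : (chart x).space k ≤ (stdFlag n).space l) : x p = 0 := by
  rw [← unitriangularGL_smul_stdFlag, smul_stdFlag_space_le_iff] at h
  have := h p.1.1 p.1.2 hk hl
  rw [coe_unitriangularGL] at this
  simpa [unitriangular, p.2] using this

/-- The incidence confines column `j` of the inverse matrix to rows `j` and `m`. Multiplying that
column by `unitriangular x` and reading rows `j`, `m`, `i` gives `v j = 1`, `v m = -x_{mj}` and the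
relation. -/
theorem coord_eq_mul_of_le_chart_space {x : LowerIndex n → ℂ} {i j m : Fin n}
    (hjm : (m : ℕ) = j + 1) (hmi : m < i) {k l : Fin (n + 1)} (hk : (j : ℕ) < k)
    (hl : (l : ℕ) ≤ j + 2) (h : (stdFlag n).space k ≤ (chart x).space l) :
    x ⟨(i, j), by rw [Fin.lt_def] at *; simp; omega⟩ =
      x ⟨(m, j), by rw [Fin.lt_def]; simp; omega⟩ * x ⟨(i, m), hmi⟩ := by
  rw [← unitriangularGL_smul_stdFlag, stdFlag_space_le_smul_iff] at h
  set v : Fin n → ℂ := fun a => (unitriangularGL x)⁻¹ a j with hv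
  have hv0 : ∀ a : Fin n, j + 2 ≤ (a : ℕ) → v a = 0 := fun a ha => h a j hk (hl.trans ha)
  have hmul : ∀ a, ∑ b, unitriangular x a b * v b = if a = j then 1 else 0 := by
    intro a
    have : (unitriangularGL x * (unitriangularGL x)⁻¹ : GL (Fin n) ℂ) a j
      = (1 : Matrix (Fin n) (Fin n) ℂ) a j := by rw [mul_inv_cancel]; rfl
    rwa [Units.val_mul, mul_apply, one_apply, coe_unitriangularGL] at this
  -- Forward substitution: the inverse is lower triangular as well.
  have hlow : ∀ N : ℕ, ∀ a : Fin n, (a : ℕ) = N → a < j → v a = 0 := by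
    intro N
    induction N using Nat.strong_induction_on with
    | _ N ih =>
      intro a ha haj
      have h1 := hmul a
      rw [Finset.sum_eq_single a, if_neg haj.ne] at h1
      · simpa [unitriangular] using h1
      · intro b _ hba
        rcases lt_or_gt_of_ne hba with hb | hb
        · rw [ih b (ha ▸ Fin.lt_def.1 hb) b rfl (hb.trans haj), mul_zero]
        · simp [unitriangular, hb.not_gt, hb.ne]
      · simp
  have hne : j ≠ m := by rintro rfl; omega
  have hsum : ∀ a, unitriangular x a j * v j + unitriangular x a m * v m =
      if a = j then 1 else 0 := by
    intro a
    rw [← hmul a, Fintype.sum_eq_add j m hne]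
    rintro b ⟨hbj, hbm⟩
    rcases lt_or_gt_of_ne hbj with hb | hb
    · rw [hlow _ b rfl hb, mul_zero]
    · rw [hv0 b, mul_zero]
      rw [Fin.lt_def] at hb
      have : (b : ℕ) ≠ m := fun h => hbm (Fin.ext h)
      omega
  have hjm' : j < m := by rw [Fin.lt_def]; omega
  have hji : j < i := hjm'.trans hmi
  have e1 := hsum j
  have e2 := hsum m
  have e3 := hsum i
  simp only [unitriangular, hjm', hji, hmi, hji.ne', hjm'.ne', hjm'.ne, hjm'.not_gt, lt_irrefl,
    dite_true, dite_false, if_true, if_false] at e1 e2 e3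
  simp only [one_mul, zero_mul, add_zero] at e1 e2
  rw [e1] at e2 e3
  linear_combination e3 - x ⟨(i, m), hmi⟩ * e2

end FlagVariety
end

/-! ### Coxeter words and initial segments -/

noncomputable section

namespace FlagVariety

open Matrix Filter Topology

variable {n : ℕ}

/-- Only `s_j` moves an index across the gap between `j` and `j + 1`. -/
theorem elemTransposition_apply_le_iff {i : Fin (n - 1)} {j : ℕ} (h : (i : ℕ) ≠ j) (a : Fin n) :
    (elemTransposition i a : ℕ) ≤ j ↔ (a : ℕ) ≤ j := by
  rw [elemTransposition, Equiv.swap_apply_def]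
  split_ifs with h1 h2
  · subst h1; simp only; omega
  · subst h2; simp only; omega
  · rfl

theorem elemTransposition_apply_le (i : Fin (n - 1)) {a : Fin n} (h : (a : ℕ) ≤ i) :
    (elemTransposition i a : ℕ) ≤ i + 1 := by
  rw [elemTransposition, Equiv.swap_apply_def]
  split_ifs <;> (try simp only) <;> omega

theorem prod_elemTransposition_apply_le_iff {l : List (Fin (n - 1))} {j : ℕ}
    (h : ∀ i ∈ l, (i : ℕ) ≠ j) (a : Fin n) :
    ((l.map elemTransposition).prod a : ℕ) ≤ j ↔ (a : ℕ) ≤ j := by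
  induction l with
  | nil => simp
  | cons i l ih =>
    rw [List.map_cons, List.prod_cons, Equiv.Perm.mul_apply,
      elemTransposition_apply_le_iff (h i (by simp)), ih fun k hk => h k (by simp [hk])]

theorem prod_elemTransposition_inv_apply_le_iff {l : List (Fin (n - 1))} {j : ℕ}
    (h : ∀ i ∈ l, (i : ℕ) ≠ j) (a : Fin n) :
    ((l.map elemTransposition).prod⁻¹ a : ℕ) ≤ j ↔ (a : ℕ) ≤ j := by
  rw [← prod_elemTransposition_apply_le_iff h]
  exact iff_of_eq (congrArg (fun b : Fin n => (b : ℕ) ≤ j) (Equiv.apply_symm_apply _ a))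

theorem elemTransposition_inv (i : Fin (n - 1)) :
    (elemTransposition i : Equiv.Perm (Fin n))⁻¹ = elemTransposition i := Equiv.swap_inv _ _

/-- A Coxeter element or its inverse sends `{1, …, k}` into `{1, …, k + 1}`, depending on the order
in which `s_k` and `s_{k+1}` enter. -/
theorem IsCoxeterElement.apply_lt_or_inv_apply_lt {w : Equiv.Perm (Fin n)}
    (hw : IsCoxeterElement w) {j : ℕ} (hj : j + 2 < n) :
    (∀ a : Fin n, (a : ℕ) < j + 1 → (w a : ℕ) < j + 2) ∨
      (∀ a : Fin n, (a : ℕ) < j + 1 → (w⁻¹ a : ℕ) < j + 2) := by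
  obtain ⟨l, hl, hmem, rfl⟩ := hw
  obtain ⟨l₁, l₂, rfl⟩ := List.append_of_mem (hmem ⟨j, by omega⟩)
  have hnd := List.nodup_append.1 hl
  have hl₁ : ∀ i ∈ l₁, (i : ℕ) ≠ j := fun i hi h =>
    hnd.2.2 i hi ⟨j, by omega⟩ (by simp) (Fin.ext h)
  have hl₂ : ∀ i ∈ l₂, (i : ℕ) ≠ j := fun i hi h =>
    (List.nodup_cons.1 hnd.2.1).1 (by rwa [← show i = ⟨j, by omega⟩ from Fin.ext h])
  simp only [List.map_append, List.map_cons, List.prod_append, List.prod_cons, Nat.lt_succ_iff,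
    _root_.mul_inv_rev, elemTransposition_inv, Equiv.Perm.mul_apply]
  -- The factors applied before `s_j` preserve `{0, …, j}`, and `s_j` enlarges it at most to `{0, …,
  -- j + 1}`. The factors applied afterwards preserve that set if `s_{j+1}` is not among them, which
  -- holds for `w⁻¹` or for `w` according to the side of `s_{j+1}`.
  by_cases h : ⟨j + 1, by omega⟩ ∈ l₁
  · right
    intro a ha
    rw [prod_elemTransposition_inv_apply_le_iff]
    · exact elemTransposition_apply_le _ ((prod_elemTransposition_inv_apply_le_iff hl₁ a).2 ha)
    · intro i hi hij
      exact hnd.2.2 _ h i (by simp [hi]) (Fin.ext hij.symm)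
  · left
    intro a ha
    rw [prod_elemTransposition_apply_le_iff]
    · exact elemTransposition_apply_le _ ((prod_elemTransposition_apply_le_iff hl₂ a).2 ha)
    · intro i hi hij
      exact h (by rwa [← show i = ⟨j + 1, by omega⟩ from Fin.ext hij])

/-! ### Lower elementary matrices and Bruhat double cosets -/

/-- The elementary matrix `1 + c E_{ij}`, `i ≠ j`, as an element of `GL(n, ℂ)`. -/
def transvectionGL (i j : Fin n) (h : i ≠ j) (c : ℂ) : GL (Fin n) ℂ where
  val := transvection i j c
  inv := transvection i j (-c)
  val_inv := by rw [transvection_mul_transvection_same _ _ h]; simp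
  inv_val := by rw [transvection_mul_transvection_same _ _ h]; simp

theorem coe_transvectionGL (i j : Fin n) (h : i ≠ j) (c : ℂ) :
    (transvectionGL i j h c : Matrix (Fin n) (Fin n) ℂ) = transvection i j c := rfl

theorem transvectionGL_inv (i j : Fin n) (h : i ≠ j) (c : ℂ) :
    (transvectionGL i j h c)⁻¹ = transvectionGL i j h (-c) := Units.ext rfl

theorem transvectionGL_apply (i j : Fin n) (h : i ≠ j) (c : ℂ) (a b : Fin n) :
    transvectionGL i j h c a b = (if a = b then 1 else 0) + if i = a ∧ j = b then c else 0 := by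
  rw [coe_transvectionGL, transvection, Matrix.add_apply, one_apply, single_apply]

theorem transvectionGL_mem_borel {i j : Fin n} (h : i < j) (c : ℂ) :
    transvectionGL i j h.ne c ∈ borel n := by
  intro a b hab
  rw [transvectionGL_apply, if_neg hab.ne', if_neg, add_zero]
  rintro ⟨rfl, rfl⟩
  exact absurd hab h.not_gt

theorem diag_ne_zero_of_mem_borel {b : GL (Fin n) ℂ} (hb : b ∈ borel n) (i : Fin n) :
    b i i ≠ 0 := by
  have h : (b : Matrix (Fin n) (Fin n) ℂ).det ≠ 0 :=
    ((isUnit_iff_isUnit_det _).1 b.isUnit).ne_zero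
  rw [det_of_isUpperTriangular fun i j hij => hb i j hij] at h
  exact Finset.prod_ne_zero_iff.1 h i (Finset.mem_univ i)

/-- The lower elementary matrix `1 + c E_{i+1,i}`. -/
def lowerRoot (i : Fin (n - 1)) (c : ℂ) : GL (Fin n) ℂ :=
  transvectionGL ⟨i + 1, by omega⟩ ⟨i, by omega⟩ (by simp) c

/-- This is the Bruhat decomposition in `GL₂`. The right factor is defined by solving the equation;
its only doubtful entry below the diagonal is `1 - c⁻¹ c = 0`. -/
theorem exists_lowerRoot_eq (i : Fin (n - 1)) {c : ℂ} (hc : c ≠ 0) :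
    ∃ b ∈ borel n, ∃ b' ∈ borel n, lowerRoot i c = b * permGL (elemTransposition i) * b' := by
  set p : Fin n := ⟨i, by omega⟩ with hp
  set q : Fin n := ⟨i + 1, by omega⟩ with hq
  have hpq : p < q := by simp [hp, hq]
  refine ⟨transvectionGL p q hpq.ne c⁻¹, transvectionGL_mem_borel hpq _,
    permGL (elemTransposition i) * ((transvectionGL p q hpq.ne c⁻¹)⁻¹ * lowerRoot i c), ?_, ?_⟩
  · intro a d hda
    rw [permGL_mul_apply, elemTransposition_inv, transvectionGL_inv, Units.val_mul,
      coe_transvectionGL, elemTransposition, Equiv.swap_apply_def, ← hp, ← hq]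
    have hM : ∀ u v, lowerRoot i c u v =
        (if u = v then 1 else 0) + if q = u ∧ p = v then c else 0 :=
      transvectionGL_apply q p hpq.ne' c
    split_ifs with h1 h2
    · rw [transvection_mul_apply_of_ne _ _ _ _ hpq.ne', hM, if_neg, if_neg, add_zero]
      · rintro ⟨-, rfl⟩; exact hda.ne' h1
      · rintro rfl; rw [h1] at hda; exact hda.not_gt hpq
    · rw [transvection_mul_apply_same, hM, hM]
      rw [h2] at hda
      simp only [hpq.ne', false_and, if_false, hda.ne', true_and, add_zero, zero_add]
      split_ifs
      · field_simp; ring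
      · simp
    · rw [transvection_mul_apply_of_ne _ _ _ _ h1, hM, if_neg hda.ne', if_neg, add_zero]
      rintro ⟨h, -⟩; exact h2 h.symm
  · have hs : permGL (elemTransposition i : Equiv.Perm (Fin n)) * permGL (elemTransposition i)
        = 1 := by
      rw [← map_mul, elemTransposition, Equiv.swap_mul_self, map_one]
    rw [mul_assoc, ← mul_assoc (permGL _) (permGL _), hs, one_mul, mul_inv_cancel_left]

/-- The length-increasing case of `sBw ⊆ BswB`. Write `b = (b x⁻¹) x` with `x` in the root subgroup
of `s`: conjugation by `s` keeps `b x⁻¹` in `B`, and `hw` makes `w⁻¹ x w` upper triangular. -/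
theorem exists_permGL_mul_mul_permGL_eq (i : Fin (n - 1)) {b : GL (Fin n) ℂ} (hb : b ∈ borel n)
    {w : Equiv.Perm (Fin n)}
    (hw : w⁻¹ (⟨i, by omega⟩ : Fin n) < w⁻¹ (⟨i + 1, by omega⟩ : Fin n)) :
    ∃ b₁ ∈ borel n, ∃ b₂ ∈ borel n, permGL (elemTransposition i) * b * permGL w =
      b₁ * permGL (elemTransposition i * w) * b₂ := by
  set p : Fin n := ⟨i, by omega⟩ with hp
  set q : Fin n := ⟨i + 1, by omega⟩ with hq
  have hpq : p < q := by simp [hp, hq]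
  set s : Equiv.Perm (Fin n) := elemTransposition i with hs
  have hsi : s⁻¹ = s := elemTransposition_inv i
  -- This value kills the `(p, q)` entry of `b x⁻¹`, the one that conjugation by `s` moves below the
  -- diagonal.
  set c : ℂ := b p q / b p p
  set x : GL (Fin n) ℂ := transvectionGL p q hpq.ne c
  have hx : ∀ u v, (b * x⁻¹ : GL (Fin n) ℂ) u v = if v = q then b u q + -c * b u p else b u v := by
    intro u v
    rw [transvectionGL_inv, Units.val_mul, coe_transvectionGL]
    split_ifs with h
    · subst h; rw [mul_transvection_apply_same]
    · rw [mul_transvection_apply_of_ne _ _ _ _ h]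
  refine ⟨permGL s * (b * x⁻¹) * permGL s⁻¹, ?_, permGL w⁻¹ * (x * permGL w), ?_, ?_⟩
  · intro a d hda
    rw [mul_permGL_apply, permGL_mul_apply, hsi]
    have hbx : b * x⁻¹ ∈ borel n := mul_mem hb (inv_mem (transvectionGL_mem_borel hpq c))
    by_cases h : a = q ∧ d = p
    · obtain ⟨rfl, rfl⟩ := h
      have h1 : s q = p := Equiv.swap_apply_right _ _
      have h2 : s p = q := Equiv.swap_apply_left _ _
      have := diag_ne_zero_of_mem_borel hb p
      rw [h1, h2, hx, if_pos rfl]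
      simp only [c]
      field_simp
      ring
    · refine hbx _ _ ?_
      rw [Fin.lt_def] at hda ⊢
      simp only [Fin.ext_iff, hp, hq] at h
      simp only [hs, elemTransposition, Equiv.swap_apply_def, Fin.ext_iff]
      split_ifs <;> (try simp only) <;> omega
  · intro a d hda
    rw [permGL_mul_apply, mul_permGL_apply, inv_inv, transvectionGL_apply, if_neg, if_neg, add_zero]
    · rintro ⟨h1, h2⟩
      rw [h1, h2] at hw
      refine hw.not_gt ?_
      simpa using hda
    · intro h; exact hda.ne' (w.injective h)
  · simp only [map_mul, map_inv]
    group

/-- A product of lower elementary matrices at distinct simple roots lies in the Bruhat double coset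
of the product of the corresponding transpositions. -/
theorem exists_prod_lowerRoot_eq {l : List (Fin (n - 1))} (hl : l.Nodup) {t : Fin (n - 1) → ℂ}
    (ht : ∀ i, t i ≠ 0) :
    ∃ b ∈ borel n, ∃ b' ∈ borel n, (l.map fun i => lowerRoot i (t i)).prod =
      b * permGL (l.map elemTransposition).prod * b' := by
  induction l with
  | nil => exact ⟨1, one_mem _, 1, one_mem _, by simp⟩
  | cons i l ih =>
    obtain ⟨hil, hl⟩ := List.nodup_cons.1 hl
    obtain ⟨b, hb, b', hb', h⟩ := ih hl
    obtain ⟨c, hc, c', hc', h'⟩ := exists_lowerRoot_eq i (ht i)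
    have hne : ∀ k ∈ l, (k : ℕ) ≠ i := by
      intro k hk hki
      rw [Fin.ext hki] at hk
      exact hil hk
    obtain ⟨b₁, hb₁, b₂, hb₂, h''⟩ := exists_permGL_mul_mul_permGL_eq i (mul_mem hc' hb)
      -- As `s_i` is absent from the tail, the tail preserves `{0, …, i}`, hence its inverse keeps
      -- `i` below `i + 1`.
      (w := (l.map elemTransposition).prod) (by
        rw [Fin.lt_def]
        refine lt_of_le_of_lt ((prod_elemTransposition_inv_apply_le_iff hne _).2 le_rfl)
          (not_le.1 fun hle => ?_)
        have := (prod_elemTransposition_inv_apply_le_iff hne _).1 hle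
        simp at this)
    refine ⟨c * b₁, mul_mem hc hb₁, b₂ * b', mul_mem hb₂ hb', ?_⟩
    rw [List.map_cons, List.prod_cons, List.map_cons, List.prod_cons, h, h']
    calc _ = c * (permGL (elemTransposition i) * (c' * b) *
          permGL (l.map elemTransposition).prod) * b' := by group
      _ = _ := by rw [h'']; group

theorem prod_lowerRoot_smul_mem_schubertCell {l : List (Fin (n - 1))} (hl : l.Nodup)
    {t : Fin (n - 1) → ℂ} (ht : ∀ i, t i ≠ 0) :
    (l.map fun i => lowerRoot i (t i)).prod • stdFlag n ∈
      schubertCell (l.map elemTransposition).prod := by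
  obtain ⟨b, hb, b', hb', h⟩ := exists_prod_lowerRoot_eq hl ht
  refine mem_schubertCell_iff.2 ⟨b, hb, ?_⟩
  rw [h, mul_smul, smul_stdFlag_of_mem_borel hb']

/-! ### Secant curves in the Schubert variety -/

/-- The matrix `R` with `∏ (1 + ε c_i E_{i+1,i}) = 1 + ε R`, the product being over the list. -/
def secantMatrix (c : Fin (n - 1) → ℂ) (ε : ℂ) : List (Fin (n - 1)) → Matrix (Fin n) (Fin n) ℂ
  | [] => 0
  | i :: l => single ⟨i + 1, by omega⟩ ⟨i, by omega⟩ (c i) + secantMatrix c ε l +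
      ε • (single ⟨i + 1, by omega⟩ ⟨i, by omega⟩ (c i) * secantMatrix c ε l)

theorem coe_prod_lowerRoot (c : Fin (n - 1) → ℂ) (ε : ℂ) (l : List (Fin (n - 1))) :
    ((l.map fun i => lowerRoot i (ε * c i)).prod : GL (Fin n) ℂ).val =
      1 + ε • secantMatrix c ε l := by
  induction l with
  | nil => simp [secantMatrix]
  | cons i l ih =>
    have h : single (⟨i + 1, by omega⟩ : Fin n) (⟨i, by omega⟩ : Fin n) (ε * c i) =
        ε • single (⟨i + 1, by omega⟩ : Fin n) (⟨i, by omega⟩ : Fin n) (c i) := by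
      rw [smul_single, smul_eq_mul]
    rw [List.map_cons, List.prod_cons, Units.val_mul, ih, lowerRoot, coe_transvectionGL,
      transvection, secantMatrix, h]
    simp only [Matrix.add_mul, Matrix.mul_add, Matrix.one_mul, Matrix.mul_one, smul_add,
      Matrix.smul_mul, Matrix.mul_smul]
    abel

theorem secantMatrix_apply_of_le (c : Fin (n - 1) → ℂ) (ε : ℂ) (l : List (Fin (n - 1)))
    {a b : Fin n} (hab : a ≤ b) : secantMatrix c ε l a b = 0 := by
  induction l generalizing a b with
  | nil => rfl
  | cons i l ih =>
    have hs : ∀ u v : Fin n, u ≤ v →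
        single (⟨i + 1, by omega⟩ : Fin n) (⟨i, by omega⟩ : Fin n) (c i) u v = 0 := by
      intro u v huv
      rw [single_apply, if_neg]
      rintro ⟨rfl, rfl⟩
      simp [Fin.le_def] at huv
    rw [secantMatrix, Matrix.add_apply, Matrix.add_apply, hs a b hab, ih hab, Matrix.smul_apply, mul_apply,
      Finset.sum_eq_zero]
    · simp
    · intro k _
      rcases le_total a k with h | h
      · rw [hs a k h, zero_mul]
      · rw [ih (h.trans hab), mul_zero]

theorem secantMatrix_zero (c : Fin (n - 1) → ℂ) (l : List (Fin (n - 1))) :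
    secantMatrix c 0 l = (l.map fun i : Fin (n - 1) =>
      single (⟨i + 1, by omega⟩ : Fin n) (⟨i, by omega⟩ : Fin n) (c i)).sum := by
  induction l with
  | nil => rfl
  | cons i l ih => rw [secantMatrix, ih, List.map_cons, List.sum_cons, zero_smul, add_zero]

theorem continuous_secantMatrix {c : ℂ → Fin (n - 1) → ℂ} (hc : Continuous c)
    (l : List (Fin (n - 1))) : Continuous fun ε => secantMatrix (c ε) ε l := by
  induction l with
  | nil => exact continuous_const
  | cons i l ih =>
    have hs : Continuous fun ε =>
        single (⟨i + 1, by omega⟩ : Fin n) (⟨i, by omega⟩ : Fin n) (c ε i) := by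
      refine continuous_matrix fun a b => ?_
      simp only [single_apply]
      split_ifs
      · exact (continuous_apply i).comp hc
      · exact continuous_const
    exact (hs.add ih).add (continuous_id.smul (hs.matrix_mul ih))

/-- Every vector of the space spanned by the simple coordinates is the limit of secants `r ε` of the
Schubert variety of a Coxeter element. -/
theorem IsCoxeterElement.exists_curve {w : Equiv.Perm (Fin n)} (hw : IsCoxeterElement w)
    {y : LowerIndex n → ℂ} (hy : ∀ p : LowerIndex n, (p.1.2 : ℕ) + 1 < (p.1.1 : ℕ) → y p = 0) :
    ∃ r : ℂ → LowerIndex n → ℂ, Continuous r ∧ r 0 = y ∧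
      ∀ᶠ ε in 𝓝[≠] (0 : ℂ), ε • r ε ∈ localSchubert w := by
  obtain ⟨l, hl, hmem, rfl⟩ := hw
  -- Some simple coordinates of `y` may vanish, while the cell requires nonzero parameters. The
  -- shift by `ε` makes all of them nonzero for small `ε ≠ 0` and disappears in the limit.
  set c : ℂ → Fin (n - 1) → ℂ := fun ε i =>
    y ⟨(⟨i + 1, by omega⟩, ⟨i, by omega⟩), by simp⟩ + ε with hc
  have hcont : Continuous c := by
    refine continuous_pi fun i => ?_
    exact continuous_const.add continuous_id
  refine ⟨fun ε p => secantMatrix (c ε) ε l p.1.1 p.1.2, ?_, ?_, ?_⟩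
  · exact continuous_pi fun p => (continuous_secantMatrix hcont l).matrix_elem _ _
  · ext p
    obtain ⟨⟨a, d⟩, hda⟩ := p
    have huniv : l.toFinset = Finset.univ := by ext; simp [hmem]
    change secantMatrix (c 0) 0 l a d = _
    rw [secantMatrix_zero, ← List.sum_toFinset _ hl, huniv, Matrix.sum_apply]
    simp only [single_apply]
    by_cases h : (d : ℕ) + 1 < a
    · rw [hy _ h, Finset.sum_eq_zero]
      intro i _
      rw [if_neg]
      rintro ⟨rfl, rfl⟩
      simp at h
    · simp only [Fin.lt_def] at hda
      rw [Finset.sum_eq_single ⟨d, by omega⟩]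
      · have ha : (⟨d + 1, by omega⟩ : Fin n) = a := Fin.ext (by simp only; omega)
        simp [hc, ha]
      · intro i _ hi
        rw [if_neg]
        rintro ⟨-, rfl⟩
        exact hi rfl
      · simp
  · have hne : ∀ᶠ ε in 𝓝[≠] (0 : ℂ), ∀ i, c ε i ≠ 0 := by
      rw [eventually_all]
      intro i
      simp only [hc]
      set z : ℂ := y ⟨(⟨i + 1, by omega⟩, ⟨i, by omega⟩), by simp⟩
      by_cases hz : z = 0
      · filter_upwards [self_mem_nhdsWithin] with ε hε
        simpa [hz] using hε
      · refine eventually_nhdsWithin_of_eventually_nhds ?_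
        have : ContinuousAt (fun ε : ℂ => z + ε) 0 := by fun_prop
        exact this.eventually_ne (by simpa using hz)
    filter_upwards [hne, self_mem_nhdsWithin] with ε hε hε0
    refine subset_closure ?_
    have hcoe := coe_prod_lowerRoot (c ε) ε l
    rw [chart_eq_smul (g := (l.map fun i => lowerRoot i (ε * c ε i)).prod)]
    · exact prod_lowerRoot_smul_mem_schubertCell hl fun i => mul_ne_zero hε0 (hε i)
    · rw [hcoe]
      ext a d
      rw [unitriangular, Matrix.add_apply, Matrix.smul_apply, one_apply]
      split_ifs with h1 h2 h2
      · exact absurd h1 h2.ne'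
      · rw [secantMatrix_apply_of_le _ _ _ h1.le]; simp
      · simp
      · rw [secantMatrix_apply_of_le _ _ _ (not_lt.1 h2)]; simp

end FlagVariety
end

/-! ### Lowest degree forms and ideals of coordinate subspaces -/

noncomputable section

namespace FlagVariety

open Filter Topology

open MvPolynomial in
theorem eval_smul_of_isHomogeneous {σ : Type*} {q : MvPolynomial σ ℂ} {d : ℕ}
    (hq : q.IsHomogeneous d) (c : ℂ) (x : σ → ℂ) : eval (c • x) q = c ^ d * eval x q := by
  rw [eval_eq, eval_eq, Finset.mul_sum]
  refine Finset.sum_congr rfl fun m hm => ?_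
  have hdeg : m.degree = d := by
    by_contra h
    exact (mem_support_iff.1 hm) (hq.coeff_eq_zero h)
  simp only [Pi.smul_apply, smul_eq_mul, mul_pow, Finset.prod_mul_distrib,
    Finset.prod_pow_eq_pow_sum]
  rw [← hdeg, Finsupp.degree_apply]
  ring

open MvPolynomial in
theorem continuous_eval_comp {σ : Type*} (q : MvPolynomial σ ℂ) {r : ℂ → σ → ℂ}
    (hr : Continuous r) : Continuous fun ε => eval (r ε) q := by
  simp only [eval_eq]
  fun_prop

open MvPolynomial in
/-- The lowest degree form of a polynomial that vanishes on the secants `ε • r ε` vanishes at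
`r 0`. -/
theorem eval_homogeneousComponent_eq_zero {σ : Type*} {f : MvPolynomial σ ℂ} {d : ℕ}
    (hd : ∀ e < d, homogeneousComponent e f = 0) {r : ℂ → σ → ℂ} (hr : Continuous r)
    (hf : ∀ᶠ ε in 𝓝[≠] (0 : ℂ), eval (ε • r ε) f = 0) :
    eval (r 0) (homogeneousComponent d f) = 0 := by
  -- For `ε ≠ 0` this is `ε⁻ᵈ f(ε r(ε))`, written so that it extends continuously to `0`.
  set g : ℂ → ℂ := fun ε => ∑ e ∈ Finset.range (f.totalDegree + 1),
    if d ≤ e then ε ^ (e - d) * eval (r ε) (homogeneousComponent e f) else 0 with hg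
  have hgc : Continuous g := by
    refine continuous_finsetSum _ fun e _ => ?_
    split_ifs
    · exact (continuous_id.pow _).mul (continuous_eval_comp _ hr)
    · exact continuous_const
  have hg0 : g 0 = eval (r 0) (homogeneousComponent d f) := by
    simp only [hg]
    by_cases hdt : f.totalDegree < d
    · rw [homogeneousComponent_eq_zero d f hdt, map_zero]
      refine Finset.sum_eq_zero fun e he => if_neg ?_
      rw [Finset.mem_range] at he
      omega
    · rw [Finset.sum_eq_single d]
      · simp
      · intro e _ hed
        split_ifs with h
        · rw [zero_pow (by omega), zero_mul]
        · rfl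
      · intro h
        rw [Finset.mem_range] at h
        omega
  have hgε : ∀ᶠ ε in 𝓝[≠] (0 : ℂ), g ε = 0 := by
    filter_upwards [hf, self_mem_nhdsWithin] with ε hε hε0
    have h : ε ^ d * g ε = 0 := by
      rw [← hε]
      conv_rhs => rw [← sum_homogeneousComponent f]
      rw [map_sum, Finset.mul_sum]
      refine Finset.sum_congr rfl fun e _ => ?_
      rw [eval_smul_of_isHomogeneous (homogeneousComponent_isHomogeneous e f)]
      split_ifs with h
      · rw [← mul_assoc, ← pow_add, Nat.add_sub_cancel' h]
      · rw [hd e (not_le.1 h)]; simp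
    exact (mul_eq_zero.1 h).resolve_left (pow_ne_zero d hε0)
  rw [← hg0]
  exact tendsto_nhds_unique ((hgc.tendsto 0).mono_left nhdsWithin_le_nhds)
    (tendsto_const_nhds.congr' (hgε.mono fun _ h => h.symm))

open MvPolynomial in
-- Setting the variables in `S` to zero does not change `q` modulo the ideal, and the result
-- vanishes at every point, so it is the zero polynomial over the infinite field `ℂ`.
theorem mem_span_X_of_eval_eq_zero {σ : Type*} (S : Set σ) {q : MvPolynomial σ ℂ}
    (hq : ∀ x : σ → ℂ, (∀ p ∈ S, x p = 0) → eval x q = 0) :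
    q ∈ Ideal.span (X '' S : Set (MvPolynomial σ ℂ)) := by
  classical
  set I := Ideal.span (X '' S : Set (MvPolynomial σ ℂ))
  set φ : MvPolynomial σ ℂ →ₐ[ℂ] MvPolynomial σ ℂ := aeval fun p => if p ∈ S then 0 else X p
  have hφ : φ q = 0 := by
    refine MvPolynomial.funext fun x => ?_
    have : eval x (φ q) = eval (fun p => if p ∈ S then 0 else x p) q := by
      rw [← coe_aeval_eq_eval, ← coe_aeval_eq_eval]
      change ((aeval x).comp φ) q = aeval _ q
      congr 1
      ext p
      simp only [φ, AlgHom.comp_apply, aeval_X]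
      split_ifs <;> simp
    rw [this, map_zero]
    exact hq _ fun p hp => if_pos hp
  have hmk : (Ideal.Quotient.mkₐ ℂ I).comp φ = Ideal.Quotient.mkₐ ℂ I := by
    ext p
    simp only [φ, AlgHom.comp_apply, aeval_X]
    split_ifs with h
    · rw [map_zero]
      exact (Ideal.Quotient.eq_zero_iff_mem.2 (Ideal.subset_span (Set.mem_image_of_mem X h))).symm
    · rfl
  have := congrArg (fun ψ : MvPolynomial σ ℂ →ₐ[ℂ] _ => ψ q) hmk
  simp only [AlgHom.comp_apply, hφ, map_zero] at this
  exact Ideal.Quotient.eq_zero_iff_mem.1 this.symm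

/-! ### The tangent cone and its ideal -/

variable {n : ℕ} {w : Equiv.Perm (Fin n)}

/-- On the Schubert variety of a Coxeter element, each coordinate `x_{ij}` with `i - j > 1` is zero
or a product of two coordinates. -/
theorem IsCoxeterElement.exists_equation (hw : IsCoxeterElement w) {p : LowerIndex n}
    (hp : (p.1.2 : ℕ) + 1 < (p.1.1 : ℕ)) :
    ∃ (s : ℂ) (a b : LowerIndex n), ∀ x ∈ localSchubert w, x p = s * (x a * x b) := by
  obtain ⟨⟨i, j⟩, hji⟩ := p
  simp only at hp
  rcases hw.apply_lt_or_inv_apply_lt (j := j) (by omega) with h | h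
  -- With `s = 0` the two coordinates are placeholders.
  · refine ⟨0, ⟨(i, j), hji⟩, ⟨(i, j), hji⟩, fun x hx => ?_⟩
    rw [zero_mul]
    exact coord_eq_zero_of_chart_space_le (k := ⟨j + 1, by omega⟩) (l := ⟨j + 2, by omega⟩)
      (by simp) (by simp only; omega) (space_le_of_mem_schubertVariety h hx)
  · refine ⟨1, ⟨(⟨j + 1, by omega⟩, j), by simp [Fin.lt_def]⟩,
      ⟨(i, ⟨j + 1, by omega⟩), by simpa [Fin.lt_def] using hp⟩, fun x hx => ?_⟩
    rw [one_mul]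
    exact coord_eq_mul_of_le_chart_space (k := ⟨j + 1, by omega⟩) (l := ⟨j + 2, by omega⟩)
      rfl (Fin.lt_def.2 hp) (by simp) le_rfl (le_space_of_mem_schubertVariety h hx)

theorem IsCoxeterElement.tangentCone_eq (hw : IsCoxeterElement w) :
    tangentCone w =
      {x : LowerIndex n → ℂ | ∀ p : LowerIndex n, (p.1.2 : ℕ) + 1 < (p.1.1 : ℕ) → x p = 0} := by
  ext y
  constructor
  · intro hy p hp
    obtain ⟨α, l, _, c, d, hd, hmem, hcd⟩ := exists_fun_of_mem_tangentConeAt hy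
    obtain ⟨s, a, b, hsab⟩ := hw.exists_equation hp
    have h1 : Tendsto (fun m => c m * d m p) l (𝓝 (y p)) := (tendsto_pi_nhds.1 hcd) p
    -- The scale `c m` is absorbed by one factor of the quadratic term; the other factor tends to
    -- zero.
    have h2 : Tendsto (fun m => s * ((c m * d m a) * d m b)) l (𝓝 (s * (y a * 0))) :=
      (((tendsto_pi_nhds.1 hcd) a).mul ((tendsto_pi_nhds.1 hd) b)).const_mul s
    rw [mul_zero, mul_zero] at h2
    refine tendsto_nhds_unique h1 (h2.congr' ?_)
    filter_upwards [hmem] with m hm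
    rw [zero_add] at hm
    rw [hsab _ hm]
    ring
  · intro hy
    obtain ⟨r, hr, rfl, hmem⟩ := hw.exists_curve hy
    refine mem_tangentConeAt_of_seq (𝓝[≠] (0 : ℂ)) (fun ε => ε⁻¹) (fun ε => ε • r ε) ?_ ?_ ?_
    · have h : Continuous fun ε : ℂ => ε • r ε := continuous_id.smul hr
      have := (h.tendsto 0).mono_left (nhdsWithin_le_nhds (s := {0}ᶜ))
      rwa [zero_smul] at this
    · simpa using hmem
    · refine ((hr.tendsto 0).mono_left nhdsWithin_le_nhds).congr' ?_
      filter_upwards [self_mem_nhdsWithin] with ε hε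
      rw [inv_smul_smul₀ hε]

open MvPolynomial in
theorem IsCoxeterElement.tangentConeIdeal_eq (hw : IsCoxeterElement w) :
    tangentConeIdeal w =
      Ideal.span {q | ∃ p : LowerIndex n, (p.1.2 : ℕ) + 1 < (p.1.1 : ℕ) ∧ q = X p} := by
  refine le_antisymm (Ideal.span_le.2 ?_) (Ideal.span_le.2 ?_)
  · rintro _ ⟨f, hf, d, hd, rfl⟩
    have h := mem_span_X_of_eval_eq_zero {p : LowerIndex n | (p.1.2 : ℕ) + 1 < (p.1.1 : ℕ)}
      (q := homogeneousComponent d f) fun y hy => by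
        obtain ⟨r, hr, rfl, hmem⟩ := hw.exists_curve hy
        exact eval_homogeneousComponent_eq_zero hd hr (hmem.mono fun ε hε => hf _ hε)
    refine Ideal.span_mono ?_ h
    rintro _ ⟨p, hp, rfl⟩
    exact ⟨p, hp, rfl⟩
  · rintro _ ⟨p, hp, rfl⟩
    obtain ⟨s, a, b, hsab⟩ := hw.exists_equation hp
    have hX : (X p : MvPolynomial (LowerIndex n) ℂ).IsHomogeneous 1 := isHomogeneous_X ℂ p
    have hC : (C s * (X a * X b) : MvPolynomial (LowerIndex n) ℂ).IsHomogeneous 2 :=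
      ((isHomogeneous_X ℂ a).mul (isHomogeneous_X ℂ b)).C_mul s
    -- The subtracted term is homogeneous of degree 2, so the lowest form is `X p`.
    refine Ideal.subset_span ⟨X p - C s * (X a * X b), fun x hx => ?_, 1, fun e he => ?_, ?_⟩
    · simp [hsab x hx]
    · rw [map_sub, homogeneousComponent_of_mem hX, homogeneousComponent_of_mem hC,
        if_neg (by omega), if_neg (by omega), sub_zero]
    · rw [map_sub, homogeneousComponent_of_mem hX, homogeneousComponent_of_mem hC,
        if_pos rfl, if_neg (by omega), sub_zero]

end FlagVariety
end

open FlagVariety in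
theorem corollary3p2 (n : ℕ) :
    (∀ w w' : Equiv.Perm (Fin n), IsCoxeterElement w → IsCoxeterElement w' →
      tangentCone w = tangentCone w' ∧ tangentConeIdeal w = tangentConeIdeal w') ∧
    (∀ w : Equiv.Perm (Fin n), IsCoxeterElement w →
      tangentCone w =
        {x : LowerIndex n → ℂ | ∀ p : LowerIndex n, (p.1.2 : ℕ) + 1 < (p.1.1 : ℕ) → x p = 0} ∧
      tangentConeIdeal w =
        Ideal.span {q | ∃ p : LowerIndex n, (p.1.2 : ℕ) + 1 < (p.1.1 : ℕ) ∧
          q = MvPolynomial.X p}) :=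
  ⟨fun _ _ hw hw' => ⟨hw.tangentCone_eq.trans hw'.tangentCone_eq.symm,
    hw.tangentConeIdeal_eq.trans hw'.tangentConeIdeal_eq.symm⟩,
  fun _ hw => ⟨hw.tangentCone_eq, hw.tangentConeIdeal_eq⟩⟩
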